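/- For a finite simple graph $G$, a subtree of $G$ is a (non-empty) subgraph of $G$ that is a tree, and the mean subtree order $\mu(G)$ is the average number of vertices of a subtree of $G$, that is, $\mu(G) = \frac{1}{|\mathcal{T}_G|}\sum_{T\in\mathcal{T}_G}|V(T)|$, where $\mathcal{T}_G$ is the set of all subtrees of $G$. Theorem. For every positive integer $k$ there are infinitely many pairs of connected finite simple graphs $G \subset H$ with $V(G)=V(H)$ and $|E(H)\setminus E(G)| = k$ such that $\mu(H) < \mu(G)$. Here pairs are counted up to isomorphism; in other words, for every $k \ge 1$ there are infinitely many $n$ for which such a pair exists on an $n$-element vertex set. -/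

import Mathlib

namespace SimpleGraph

/-- The family of subtrees of a finite graph `G`: all subgraphs of `G` that are trees.
`IsTree` asks for connectedness, hence for a vertex, so the empty subgraph is not a subtree. -/
noncomputable def subtrees {V : Type*} [Finite V] (G : SimpleGraph V) : Finset G.Subgraph :=
  (Set.toFinite {T : G.Subgraph | T.coe.IsTree}).toFinset

/-- The mean subtree order of a finite graph `G`: the average number of vertices of a
subtree of `G`. -/
noncomputable def meanSubtreeOrder {V : Type*} [Finite V] (G : SimpleGraph V) : ℚ :=
  (∑ T ∈ G.subtrees, (T.verts.ncard : ℚ)) / (G.subtrees.card : ℚ)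

end SimpleGraph

/-! Attach `m` pendant vertices to each of `r` hubs of a fixed core. A core subtree with `s` hubs
extends to `2 ^ (s * m)` subtrees, carrying `s * m / 2` pendant vertices on average. As `m` grows,
the core subtrees containing every hub dominate, so the mean order is `r * m / 2` plus the mean
order of those core subtrees, up to `o(1)` (`tendsto_meanSubtreeOrder_hubExtension`). It remains to
compare two cores on `k + 2` vertices, the hubs being the leaves of a star. In the star, only the
spanning tree contains all leaves, so the limit is `k + 2`. Joining one leaf to the `k` others
creates a subtree that contains all leaves but omits the centre, which pulls the limit below `k +
2`. For all large `m` the `k` added edges therefore lower the mean. -/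

namespace SimpleGraph

/-! ### Pendant extensions: connectedness, edges, trees -/

variable {C P : Type*}

/-- The graph obtained from `G` by attaching, for each `p : P`, a pendant vertex to `h p`. -/
def pendantExtension (G : SimpleGraph C) (h : P → C) : SimpleGraph (C ⊕ P) where
  Adj
    | .inl a, .inl b => G.Adj a b
    | .inl a, .inr p => h p = a
    | .inr p, .inl a => h p = a
    | .inr _, .inr _ => False
  symm := ⟨by rintro (a | p) (b | q) <;> simp [G.adj_comm]⟩
  loopless := ⟨by rintro (a | p) <;> simp⟩

section Basic

variable (G : SimpleGraph C) (h : P → C)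

@[simp] lemma pendantExtension_adj_inl_inl {a b : C} :
    (G.pendantExtension h).Adj (.inl a) (.inl b) ↔ G.Adj a b := Iff.rfl

@[simp] lemma pendantExtension_adj_inl_inr {a : C} {p : P} :
    (G.pendantExtension h).Adj (.inl a) (.inr p) ↔ h p = a := Iff.rfl

@[simp] lemma pendantExtension_adj_inr_inl {a : C} {p : P} :
    (G.pendantExtension h).Adj (.inr p) (.inl a) ↔ h p = a := Iff.rfl

@[simp] lemma pendantExtension_adj_inr_inr {p q : P} :
    ¬ (G.pendantExtension h).Adj (.inr p) (.inr q) := id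

lemma pendantExtension_mono {G H : SimpleGraph C} (hGH : G ≤ H) (h : P → C) :
    G.pendantExtension h ≤ H.pendantExtension h := by
  rintro (a | p) (b | q) hab <;> simp_all [hGH _]

/-- The inclusion of `G` in a pendant extension. -/
def pendantInl : G →g G.pendantExtension h where
  toFun := Sum.inl
  map_rel' := by simp

@[simp] lemma pendantInl_apply (a : C) : G.pendantInl h a = .inl a := rfl

variable {G}

/-- Needed for the retraction of a pendant extension onto its core: it collapses pendant edges, so
it is not a graph homomorphism. -/
lemma Reachable.of_map_adj {V W : Type*} {A : SimpleGraph V} {B : SimpleGraph W} (f : V → W)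
    (hf : ∀ x y, A.Adj x y → B.Reachable (f x) (f y)) {x y : V} (hxy : A.Reachable x y) :
    B.Reachable (f x) (f y) := by
  obtain ⟨w⟩ := hxy
  induction w with
  | nil => rfl
  | cons hadj _ ih => exact (hf _ _ hadj).trans ih

lemma pendantExtension_connected_iff : (G.pendantExtension h).Connected ↔ G.Connected := by
  constructor
  · intro hc
    have : Nonempty C := by
      obtain ⟨a | p⟩ := hc.nonempty
      · exact ⟨a⟩
      · exact ⟨h p⟩
    refine ⟨fun a b => ?_⟩
    refine Reachable.of_map_adj (Sum.elim id h) ?_ (hc.preconnected (.inl a) (.inl b))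
    rintro (a | p) (b | q) hab <;> simp_all [Adj.reachable]
  · intro hc
    obtain ⟨c⟩ := hc.nonempty
    have key : ∀ x, (G.pendantExtension h).Reachable x (.inl c) := by
      have h1 : ∀ a, (G.pendantExtension h).Reachable (.inl a) (.inl c) := fun a =>
        (hc.preconnected a c).map (G.pendantInl h)
      rintro (a | p)
      · exact h1 a
      · exact (Adj.reachable (by simp : (G.pendantExtension h).Adj (.inr p) (.inl (h p)))).trans
          (h1 _)
    have : Nonempty (C ⊕ P) := ⟨.inl c⟩
    exact ⟨fun x y => (key x).trans (key y).symm⟩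

lemma edgeSet_pendantExtension :
    (G.pendantExtension h).edgeSet =
      Sym2.map Sum.inl '' G.edgeSet ∪ Set.range fun p => s(.inl (h p), .inr p) := by
  ext e
  induction e with | _ x y
  constructor
  · rcases x with a | p <;> rcases y with b | q <;> intro hxy
    · exact .inl ⟨s(a, b), by simpa using hxy, rfl⟩
    · exact .inr ⟨q, by simp_all⟩
    · exact .inr ⟨p, by simp_all [Sym2.eq_swap]⟩
    · simp at hxy
  · rintro (⟨e, he, hxy⟩ | ⟨p, hp⟩)
    · induction e with | _ a b
      rw [← hxy]; simpa using he
    · rw [← hp]; simp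

/-- Vertex and edge counts both grow by the size of `P`, so the criterion "connected with one edge
fewer than vertices" is unaffected. -/
lemma pendantExtension_isTree_iff [Finite C] [Finite P] :
    (G.pendantExtension h).IsTree ↔ G.IsTree := by
  have hcard : Nat.card (G.pendantExtension h).edgeSet = Nat.card G.edgeSet + Nat.card P := by
    rw [Nat.card_coe_set_eq, edgeSet_pendantExtension, Set.ncard_union_eq,
      Set.ncard_image_of_injective _ (Sym2.map.injective Sum.inl_injective),
      ← Set.image_univ, Set.ncard_image_of_injective, Set.ncard_univ, Nat.card_coe_set_eq]
    · intro p q hpq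
      simpa [and_iff_right_of_imp (congrArg h)] using hpq
    · rw [Set.disjoint_left]
      rintro _ ⟨e, -, rfl⟩ ⟨p, hp⟩
      induction e with | _ a b
      simp at hp
  rw [isTree_iff_connected_and_card, isTree_iff_connected_and_card,
    pendantExtension_connected_iff, hcard, Nat.card_sum]
  exact and_congr_right fun _ => by omega

lemma ncard_edgeSet_pendantExtension_diff (G H : SimpleGraph C) (h : P → C) :
    ((H.pendantExtension h).edgeSet \ (G.pendantExtension h).edgeSet).ncard =
      (H.edgeSet \ G.edgeSet).ncard := by
  rw [← Set.ncard_image_of_injective (H.edgeSet \ G.edgeSet) (Sym2.map.injective (Sum.inl_injective (β := P)))]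
  congr 1
  ext e
  induction e with | _ x y
  constructor
  · rcases x with a | p <;> rcases y with b | q <;> rintro ⟨h1, h2⟩
    · exact ⟨s(a, b), ⟨by simpa using h1, by simpa using h2⟩, rfl⟩
    all_goals simp_all
  · rintro ⟨e, he, hxy⟩
    induction e with | _ a b
    rw [← hxy]; simpa using he

end Basic

/-! ### Subtrees of a pendant extension -/

section Subtrees

variable {G : SimpleGraph C} (h : P → C)

/-- The subgraph of a pendant extension consisting of a subgraph `T` of the core and those pendant
vertices in `Q`. -/
def Subgraph.pendantExtend (T : G.Subgraph) (Q : Set P) : (G.pendantExtension h).Subgraph where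
  verts := Sum.inl '' T.verts ∪ Sum.inr '' Q
  Adj
    | .inl a, .inl b => T.Adj a b
    | .inl a, .inr p => p ∈ Q ∧ h p = a ∧ a ∈ T.verts
    | .inr p, .inl a => p ∈ Q ∧ h p = a ∧ a ∈ T.verts
    | .inr _, .inr _ => False
  adj_sub := by rintro (a | p) (b | q) <;> simp +contextual; exact T.adj_sub
  edge_vert := by rintro (a | p) (b | q) <;> simp +contextual; exact T.edge_vert
  symm := ⟨by rintro (a | p) (b | q) <;> simp [T.adj_comm]⟩

namespace Subgraph

lemma pendantExtend_isTree_iff [Finite C] [Finite P] (T : G.Subgraph) {Q : Set P}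
    (hQ : ∀ p ∈ Q, h p ∈ T.verts) : (T.pendantExtend h Q).coe.IsTree ↔ T.coe.IsTree := by
  rw [← pendantExtension_isTree_iff (fun p : Q => (⟨h p, hQ p p.2⟩ : T.verts))]
  let f : T.verts ⊕ Q → (T.pendantExtend h Q).verts :=
    Sum.elim (fun a => ⟨.inl a, .inl ⟨a, a.2, rfl⟩⟩) (fun p => ⟨.inr p, .inr ⟨p, p.2, rfl⟩⟩)
  have hf : Function.Bijective f := by
    constructor
    · rintro (⟨a, ha⟩ | ⟨p, hp⟩) (⟨b, hb⟩ | ⟨q, hq⟩) hab <;>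
        simpa [f] using congrArg Subtype.val hab
    · rintro ⟨_, (⟨a, ha, rfl⟩ | ⟨p, hp, rfl⟩)⟩
      · exact ⟨.inl ⟨a, ha⟩, rfl⟩
      · exact ⟨.inr ⟨p, hp⟩, rfl⟩
  refine (Iso.isTree_iff ⟨Equiv.ofBijective f hf, ?_⟩).symm
  rintro (⟨a, ha⟩ | ⟨p, hp⟩) (⟨b, hb⟩ | ⟨q, hq⟩)
  · exact Iff.rfl
  · change q ∈ Q ∧ h q = a ∧ a ∈ T.verts ↔ (⟨h q, hQ q hq⟩ : T.verts) = ⟨a, ha⟩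
    simp [hq, ha]
  · change p ∈ Q ∧ h p = b ∧ b ∈ T.verts ↔ (⟨h p, hQ p hp⟩ : T.verts) = ⟨b, hb⟩
    simp [hp, hb]
  · exact Iff.rfl

lemma ncard_verts_pendantExtend [Finite C] [Finite P] (T : G.Subgraph) (Q : Set P) :
    (T.pendantExtend h Q).verts.ncard = T.verts.ncard + Q.ncard := by
  rw [pendantExtend, Set.ncard_union_eq, Set.ncard_image_of_injective _ Sum.inl_injective,
    Set.ncard_image_of_injective _ Sum.inr_injective]
  rw [Set.disjoint_left]
  rintro _ ⟨a, -, rfl⟩ ⟨p, -, hp⟩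
  simp at hp

/-- Connectedness and a second vertex give the pendant vertex a neighbour in `T`, and its hub is the
only candidate. -/
lemma adj_of_inr_mem {T : (G.pendantExtension h).Subgraph} (hT : T.Connected) {p : P}
    (hp : .inr p ∈ T.verts) {x : C ⊕ P} (hx : x ∈ T.verts) (hne : x ≠ .inr p) :
    T.Adj (.inr p) (.inl (h p)) := by
  have : Nontrivial T.verts := ⟨⟨x, hx⟩, ⟨_, hp⟩, by simpa [Subtype.ext_iff] using hne⟩
  obtain ⟨u, hu⟩ := hT.preconnected.exists_adj_of_nontrivial ⟨_, hp⟩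
  have hG := T.adj_sub hu
  rcases u with a | q
  · rw [pendantExtension_adj_inr_inl] at hG
    rwa [hG]
  · simp at hG

lemma pendantExtend_comap {T : (G.pendantExtension h).Subgraph} (hT : T.Connected) {c : C}
    (hc : .inl c ∈ T.verts) :
    (T.comap (G.pendantInl h)).pendantExtend h (Sum.inr ⁻¹' T.verts) = T := by
  have hadj : ∀ p, .inr p ∈ T.verts → T.Adj (.inr p) (.inl (h p)) := fun p hp =>
    adj_of_inr_mem h hT hp hc (by simp)
  have hinr : ∀ p a, T.Adj (.inr p) (.inl a) ↔ .inr p ∈ T.verts ∧ h p = a ∧ .inl a ∈ T.verts := by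
    intro p a
    constructor
    · intro hpa
      exact ⟨T.edge_vert hpa, T.adj_sub hpa, T.edge_vert hpa.symm⟩
    · rintro ⟨hp, rfl, -⟩
      exact hadj p hp
  ext x y
  · rcases x with a | p <;> simp [pendantExtend]
  · rcases x with a | p <;> rcases y with b | q
    · simp only [pendantExtend, comap_adj, pendantInl_apply]
      exact and_iff_right_of_imp fun hab => T.adj_sub hab
    · simp [pendantExtend, T.adj_comm (.inl a), hinr]
    · simp [pendantExtend, hinr]
    · simpa [pendantExtend] using fun hab : T.Adj _ _ => pendantExtension_adj_inr_inr G h (T.adj_sub hab)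

lemma comap_pendantExtend (T : G.Subgraph) (Q : Set P) :
    (T.pendantExtend h Q).comap (G.pendantInl h) = T := by
  ext x y
  · simp [pendantExtend]
  · simpa [pendantExtend] using fun hab => T.adj_sub hab

end Subgraph

lemma mem_subtrees {V : Type*} [Finite V] {G : SimpleGraph V} {T : G.Subgraph} :
    T ∈ G.subtrees ↔ T.coe.IsTree := by simp [subtrees]

open Classical in
/-- A subtree of a pendant extension is a single pendant vertex, or a subtree of the core together
with a set of pendant vertices attached to it. -/
lemma sum_subtrees_pendantExtension [Finite C] [Fintype P] {M : Type*} [AddCommMonoid M]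
    (f : ℕ → M) :
    ∑ T ∈ (G.pendantExtension h).subtrees, f T.verts.ncard =
      Fintype.card P • f 1 + ∑ T ∈ G.subtrees,
        ∑ Q ∈ (Finset.univ.filter fun p => h p ∈ T.verts).powerset, f (T.verts.ncard + Q.card) := by
  -- Subtrees that miss the core are single pendant vertices; the others correspond to pairs of a
  -- core subtree and a set of pendant vertices at it.
  rw [← Finset.sum_filter_not_add_sum_filter _ (fun T => ∃ c, Sum.inl c ∈ T.verts)]
  congr 1
  · rw [← Finset.card_univ, ← Finset.sum_const]
    symm
    refine Finset.sum_bij (fun p _ => (G.pendantExtension h).singletonSubgraph (.inr p)) ?_ ?_ ?_ ?_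
    · intro p _
      simp [mem_subtrees, IsTree.coe_singletonSubgraph]
    · intro p _ q _ hpq
      simpa using congrArg Subgraph.verts hpq
    · intro T hT
      simp only [Finset.mem_filter, mem_subtrees, not_exists] at hT
      obtain ⟨hT, hc⟩ := hT
      have hconn : T.Connected := ⟨hT.connected⟩
      obtain ⟨x, hx⟩ := hconn.nonempty
      rcases x with a | p
      · exact (hc a hx).elim
      have hall : ∀ x ∈ T.verts, x = .inr p := by
        intro x hx'
        by_contra hne
        exact hc _ (T.edge_vert (Subgraph.adj_of_inr_mem h hconn hx hx' hne).symm)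
      refine ⟨p, Finset.mem_univ _, ?_⟩
      ext x y
      · simp only [singletonSubgraph_verts, Set.mem_singleton_iff]
        exact ⟨fun hxp => hxp ▸ hx, hall x⟩
      · simp only [singletonSubgraph_adj, Pi.bot_apply, Prop.bot_eq_false, false_iff]
        intro hxy
        exact hxy.ne ((hall x (T.edge_vert hxy)).trans (hall y (T.edge_vert hxy.symm)).symm)
    · simp
  · rw [Finset.sum_sigma']
    symm
    refine Finset.sum_bij' (fun x _ => x.1.pendantExtend h x.2)
      (fun T _ => ⟨T.comap (G.pendantInl h), Finset.univ.filter fun p => .inr p ∈ T.verts⟩)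
      ?_ ?_ ?_ ?_ ?_
    · rintro ⟨T, Q⟩ hTQ
      simp only [Finset.mem_sigma, mem_subtrees, Finset.mem_powerset, Finset.subset_iff,
        Finset.mem_filter, Finset.mem_univ, true_and] at hTQ ⊢
      obtain ⟨⟨c, hc⟩⟩ := hTQ.1.connected.nonempty
      exact ⟨(T.pendantExtend_isTree_iff h fun p hp => hTQ.2 (by simpa using hp)).2 hTQ.1,
        c, .inl ⟨c, hc, rfl⟩⟩
    · intro T hT
      simp only [Finset.mem_filter, mem_subtrees] at hT
      obtain ⟨hT, c, hc⟩ := hT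
      have hconn : T.Connected := ⟨hT.connected⟩
      have hsub : ∀ p ∈ (Sum.inr ⁻¹' T.verts : Set P),
          h p ∈ (T.comap (G.pendantInl h)).verts := fun p hp =>
        T.edge_vert (Subgraph.adj_of_inr_mem h hconn hp hc (by simp)).symm
      simp only [Finset.mem_sigma, mem_subtrees, Finset.mem_powerset, Finset.subset_iff,
        Finset.mem_filter, Finset.mem_univ, true_and]
      refine ⟨?_, hsub⟩
      rw [← Subgraph.pendantExtend_isTree_iff h _ hsub, Subgraph.pendantExtend_comap h hconn hc]
      exact hT
    · rintro ⟨T, Q⟩ _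
      simp only [Subgraph.comap_pendantExtend, Sigma.mk.injEq, heq_eq_eq, true_and]
      ext p
      simp [Subgraph.pendantExtend]
    · intro T hT
      simp only [Finset.mem_filter, mem_subtrees] at hT
      obtain ⟨hT, c, hc⟩ := hT
      have hconn : T.Connected := ⟨hT.connected⟩
      simpa [Set.preimage] using Subgraph.pendantExtend_comap h hconn hc
    · rintro ⟨T, Q⟩ _
      simp [Subgraph.ncard_verts_pendantExtend, Set.ncard_coe_finset]

end Subtrees

/-! ### Asymptotics of the mean with many pendant vertices -/

open Filter Topology

lemma two_mul_sum_card_powerset {α : Type*} (s : Finset α) :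
    2 * ∑ t ∈ s.powerset, t.card = s.card * 2 ^ s.card := by
  classical
  induction s using Finset.induction_on with
  | empty => simp
  | insert a s ha ih =>
    have hcard : ∀ t ∈ s.powerset, (insert a t).card = t.card + 1 := fun t ht =>
      Finset.card_insert_of_notMem fun hat => ha (Finset.mem_powerset.1 ht hat)
    rw [Finset.sum_powerset_insert ha, Finset.sum_congr rfl hcard, Finset.sum_add_distrib,
      Finset.sum_const, Finset.card_powerset, Finset.card_insert_of_notMem ha, smul_eq_mul, mul_one,
      pow_succ]
    linear_combination 2 * ih

lemma sum_add_card_powerset {α : Type*} (s : Finset α) (t : ℝ) :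
    ∑ Q ∈ s.powerset, (t + Q.card) = 2 ^ s.card * (t + s.card / 2) := by
  have h : ((2 * ∑ t ∈ s.powerset, t.card : ℕ) : ℝ) = (s.card * 2 ^ s.card : ℕ) :=
    mod_cast two_mul_sum_card_powerset s
  rw [Finset.sum_add_distrib, Finset.sum_const, Finset.card_powerset, nsmul_eq_mul]
  push_cast at h ⊢
  linear_combination h / 2

section Limit

variable {C ι : Type*} [Fintype ι] (G : SimpleGraph C) (h : ι → C)

open Classical in
/-- The number of hubs contained in a subgraph. -/
noncomputable def Subgraph.hubCount {G : SimpleGraph C} (h : ι → C) (T : G.Subgraph) : ℕ :=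
  (Finset.univ.filter fun i => h i ∈ T.verts).card

lemma Subgraph.hubCount_le {G : SimpleGraph C} (T : G.Subgraph) :
    T.hubCount h ≤ Fintype.card ι := Finset.card_le_univ _

lemma Subgraph.hubCount_eq_card_iff {G : SimpleGraph C} {T : G.Subgraph} :
    T.hubCount h = Fintype.card ι ↔ ∀ i, h i ∈ T.verts := by
  simp [hubCount, Finset.card_eq_iff_eq_univ, Finset.filter_eq_self]

/-- The graph `G` with `m` pendant vertices attached to each hub. -/
abbrev hubExtension (m : ℕ) : SimpleGraph (C ⊕ ι × Fin m) :=
  G.pendantExtension fun p : ι × Fin m => h p.1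

open Classical in
lemma card_filter_hub {G : SimpleGraph C} (T : G.Subgraph) (m : ℕ) :
    (Finset.univ.filter fun p : ι × Fin m => h p.1 ∈ T.verts).card = T.hubCount h * m := by
  have : (Finset.univ.filter fun p : ι × Fin m => h p.1 ∈ T.verts) =
      (Finset.univ.filter fun i => h i ∈ T.verts) ×ˢ Finset.univ := by
    ext; simp
  rw [this, Finset.card_product, Finset.card_fin, Subgraph.hubCount]

variable [Finite C]

lemma card_subtrees_hubExtension (m : ℕ) :
    ((G.hubExtension h m).subtrees.card : ℝ) =
      Fintype.card ι * m + ∑ T ∈ G.subtrees, 2 ^ (T.hubCount h * m) := by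
  classical
  have := sum_subtrees_pendantExtension (G := G) (fun p : ι × Fin m => h p.1) (fun _ => (1 : ℝ))
  simpa [card_filter_hub] using this

lemma sum_ncard_subtrees_hubExtension (m : ℕ) :
    (∑ T ∈ (G.hubExtension h m).subtrees, (T.verts.ncard : ℝ)) =
      Fintype.card ι * m + ∑ T ∈ G.subtrees,
        2 ^ (T.hubCount h * m) * (T.verts.ncard + (T.hubCount h * m : ℝ) / 2) := by
  classical
  have := sum_subtrees_pendantExtension (G := G) (fun p : ι × Fin m => h p.1) (fun n => (n : ℝ))
  simpa [card_filter_hub, sum_add_card_powerset] using this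

lemma tendsto_pow_mul_two_pow_div {s r : ℕ} (hsr : s < r) (j : ℕ) :
    Tendsto (fun m : ℕ => (m : ℝ) ^ j * (2 ^ (s * m) / 2 ^ (r * m))) atTop (𝓝 0) := by
  have hlt : ((2 : ℝ) ^ s / 2 ^ r) < 1 := by
    rw [div_lt_one (by positivity)]
    exact pow_lt_pow_right₀ (by norm_num) hsr
  have hpos : 0 ≤ ((2 : ℝ) ^ s / 2 ^ r) := by positivity
  refine (tendsto_pow_const_mul_const_pow_of_abs_lt_one j
    (by rwa [abs_of_nonneg hpos])).congr fun m => ?_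
  rw [div_pow, ← pow_mul, ← pow_mul]

open Classical in
/-- The subtrees containing all hubs. -/
noncomputable def hubSubtrees : Finset G.Subgraph :=
  G.subtrees.filter fun T => ∀ i, h i ∈ T.verts

lemma mem_hubSubtrees {G : SimpleGraph C} {T : G.Subgraph} :
    T ∈ G.hubSubtrees h ↔ T.coe.IsTree ∧ ∀ i, h i ∈ T.verts := by
  simp [hubSubtrees, mem_subtrees]

variable [Nonempty ι]

/-- After normalisation a core subtree contributes exactly 1 if it contains all hubs, and an
exponentially small amount otherwise. -/
lemma tendsto_card_subtrees_hubExtension :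
    Tendsto (fun m => ((G.hubExtension h m).subtrees.card : ℝ) / 2 ^ (Fintype.card ι * m)) atTop
      (𝓝 (G.hubSubtrees h).card) := by
  classical
  set r := Fintype.card ι with hr
  have hr0 : 0 < r := Fintype.card_pos
  have hlim : ∀ T ∈ G.subtrees, Tendsto
      (fun m : ℕ => (2 : ℝ) ^ (T.hubCount h * m) / 2 ^ (r * m)) atTop
      (𝓝 (if ∀ i, h i ∈ T.verts then 1 else 0)) := by
    intro T _
    split_ifs with hT
    · rw [← Subgraph.hubCount_eq_card_iff] at hT
      simp [hT, ← hr]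
    · rw [← Subgraph.hubCount_eq_card_iff] at hT
      simpa using tendsto_pow_mul_two_pow_div (lt_of_le_of_ne (T.hubCount_le h) hT) 0
  have h1 := ((tendsto_pow_mul_two_pow_div hr0 1).const_mul (r : ℝ)).add
    (tendsto_finsetSum _ hlim)
  convert h1 using 2 with m
  · rw [card_subtrees_hubExtension, add_div, Finset.sum_div]
    simp; ring
  · simp [hubSubtrees]

/-- Subtracting `r * m / 2` per subtree cancels the mean pendant count exactly for core subtrees
with all hubs; for the others the remaining linear factor in `m` is beaten by exponential decay. -/
lemma tendsto_sum_subtrees_hubExtension :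
    Tendsto (fun m : ℕ => ((∑ T ∈ (G.hubExtension h m).subtrees, (T.verts.ncard : ℝ)) -
        Fintype.card ι * m / 2 * (G.hubExtension h m).subtrees.card) / 2 ^ (Fintype.card ι * m))
      atTop (𝓝 (∑ T ∈ G.hubSubtrees h, (T.verts.ncard : ℝ))) := by
  classical
  set r := Fintype.card ι with hr
  have hr0 : 0 < r := Fintype.card_pos
  have hlim : ∀ T ∈ G.subtrees, Tendsto
      (fun m : ℕ => (2 : ℝ) ^ (T.hubCount h * m) / 2 ^ (r * m) *
        (T.verts.ncard - ((r : ℝ) - T.hubCount h) / 2 * m)) atTop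
      (𝓝 (if ∀ i, h i ∈ T.verts then (T.verts.ncard : ℝ) else 0)) := by
    intro T _
    split_ifs with hT
    · rw [← Subgraph.hubCount_eq_card_iff] at hT
      simp [hT, ← hr]
    · rw [← Subgraph.hubCount_eq_card_iff] at hT
      have hlt := lt_of_le_of_ne (T.hubCount_le h) hT
      have h1 := ((tendsto_pow_mul_two_pow_div hlt 0).const_mul (T.verts.ncard : ℝ)).sub
        ((tendsto_pow_mul_two_pow_div hlt 1).const_mul (((r : ℝ) - T.hubCount h) / 2))
      convert h1 using 2 with m
      · simp only [← hr]; ring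
      · simp
  -- The `r * m` single pendant vertices have order 1 and are each shifted by `r * m / 2`, hence the
  -- terms in `m` and `m ^ 2`.
  have h1 := (((tendsto_pow_mul_two_pow_div hr0 1).const_mul (r : ℝ)).sub
    ((tendsto_pow_mul_two_pow_div hr0 2).const_mul ((r : ℝ) ^ 2 / 2))).add
    (tendsto_finsetSum _ hlim)
  convert h1 using 2 with m
  · rw [card_subtrees_hubExtension, sum_ncard_subtrees_hubExtension, ← hr]
    have h2 : ∀ T : G.Subgraph, (2 : ℝ) ^ (T.hubCount h * m) / 2 ^ (r * m) *
        (T.verts.ncard - ((r : ℝ) - T.hubCount h) / 2 * m) =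
        (2 ^ (T.hubCount h * m) * (T.verts.ncard + (T.hubCount h * m : ℝ) / 2) -
          r * m / 2 * 2 ^ (T.hubCount h * m)) / 2 ^ (r * m) := fun T => by ring
    rw [Finset.sum_congr rfl fun T _ => h2 T, ← Finset.sum_div, Finset.sum_sub_distrib,
      ← Finset.mul_sum]
    simp only [zero_mul, pow_zero]
    ring
  · simp [hubSubtrees, Finset.sum_filter]

/-- Up to the expected number of pendant vertices, the mean subtree order of a hub extension
approaches the mean order of the subtrees of the core that contain all hubs. -/
lemma tendsto_meanSubtreeOrder_hubExtension (hne : (G.hubSubtrees h).Nonempty) :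
    Tendsto (fun m : ℕ => ((G.hubExtension h m).meanSubtreeOrder : ℝ) - Fintype.card ι * m / 2)
      atTop (𝓝 ((∑ T ∈ G.hubSubtrees h, (T.verts.ncard : ℝ)) / (G.hubSubtrees h).card)) := by
  have hcard : ((G.hubSubtrees h).card : ℝ) ≠ 0 := by
    simpa using hne.ne_empty
  have hN := tendsto_card_subtrees_hubExtension G h
  refine ((tendsto_sum_subtrees_hubExtension G h).div hN hcard).congr' ?_
  filter_upwards [hN.eventually_ne hcard] with m hm
  have hm' : ((G.hubExtension h m).subtrees.card : ℝ) ≠ 0 := fun h0 => hm (by rw [h0, zero_div])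
  simp only [Pi.div_apply]
  rw [div_div_div_cancel_right₀ (by positivity), sub_div, mul_div_cancel_right₀ _ hm',
    meanSubtreeOrder]
  push_cast
  rfl

end Limit

/-! ### Invariance under isomorphism -/

section Iso

variable {V W : Type*} [Finite V] [Finite W] {G : SimpleGraph V} {H : SimpleGraph W}

lemma Iso.sum_subtrees {M : Type*} [AddCommMonoid M] (e : G ≃g H) (f : ℕ → M) :
    ∑ T ∈ G.subtrees, f T.verts.ncard = ∑ T ∈ H.subtrees, f T.verts.ncard := by
  have hinv : ∀ T : H.Subgraph, (T.map e.symm.toHom).map e.toHom = T := fun T => by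
    rw [← Subgraph.map_comp]
    convert T.map_id
    ext; simp
  refine Finset.sum_bij (fun T _ => T.map e.toHom) ?_ ?_ ?_ ?_
  · intro T hT
    rw [mem_subtrees] at hT ⊢
    exact (Iso.isTree_iff (e.toCopy.isoSubgraphMap T)).1 hT
  · intro T _ T' _ hTT
    have hinv' : ∀ T : G.Subgraph, (T.map e.toHom).map e.symm.toHom = T := fun T => by
      rw [← Subgraph.map_comp]
      convert T.map_id
      ext; simp
    rw [← hinv' T, ← hinv' T', hTT]
  · intro T hT
    rw [mem_subtrees] at hT
    exact ⟨_, mem_subtrees.2 ((Iso.isTree_iff (e.symm.toCopy.isoSubgraphMap T)).1 hT), hinv T⟩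
  · intro T _
    exact congrArg f (Set.ncard_image_of_injective T.verts e.injective).symm

lemma Iso.meanSubtreeOrder_eq (e : G ≃g H) : G.meanSubtreeOrder = H.meanSubtreeOrder := by
  have h1 := e.sum_subtrees (fun n => (n : ℚ))
  have h2 := e.sum_subtrees (fun _ => (1 : ℚ))
  simp only [Finset.sum_const, nsmul_eq_mul, mul_one] at h2
  rw [meanSubtreeOrder, meanSubtreeOrder, h1, h2]

end Iso

/-! ### The two cores: a star and a union of two stars -/

section DoubleStar

variable {V : Type*}

/-- The new edges join `y` to the vertices other than `x` and `y`, since `xy` already lies in the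
first star. -/
lemma ncard_edgeSet_sup_starGraph_diff [Finite V] {x y : V} (hxy : x ≠ y) :
    ((starGraph x ⊔ starGraph y).edgeSet \ (starGraph x).edgeSet).ncard = Nat.card V - 2 := by
  have : (starGraph x ⊔ starGraph y).edgeSet \ (starGraph x).edgeSet =
      (fun z => s(y, z)) '' ({x, y} : Set V)ᶜ := by
    ext e
    induction e with | _ a b
    simp only [edgeSet_sup, Set.mem_sdiff, Set.mem_union, mem_edgeSet, starGraph_adj, Set.mem_image,
      Set.mem_compl_iff, Set.mem_insert_iff, Set.mem_singleton_iff, Sym2.eq_iff]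
    constructor
    · rintro ⟨h1, h2⟩
      rcases h1 with h1 | ⟨hne, rfl | rfl⟩
      · exact (h2 h1).elim
      · exact ⟨b, by grind⟩
      · exact ⟨a, by grind⟩
    · grind
  rw [this, Set.ncard_image_of_injective, Set.ncard_compl, Set.ncard_pair hxy]
  intro a b hab
  exact Sym2.congr_right.1 hab

variable {ι : Type*} [Fintype ι] {x : V} {h : ι → V}

/-- A subtree of a star with at least two leaves that contains all leaves is spanning. -/
lemma verts_eq_univ_of_mem_hubSubtrees [Finite V] [Nontrivial ι]
    (hx : Set.range h = {x}ᶜ) (hinj : h.Injective)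
    {T : (starGraph x).Subgraph} (hT : T ∈ (starGraph x).hubSubtrees h) : T.verts = Set.univ := by
  rw [mem_hubSubtrees] at hT
  obtain ⟨hT, hh⟩ := hT
  obtain ⟨i, j, hij⟩ := exists_pair_ne ι
  have : Nontrivial T.verts := ⟨⟨_, hh i⟩, ⟨_, hh j⟩, by simpa [Subtype.ext_iff] using hinj.ne hij⟩
  have hc : T.Connected := ⟨hT.connected⟩
  obtain ⟨u, hu⟩ := hc.preconnected.exists_adj_of_nontrivial ⟨_, hh i⟩
  have hne : h i ≠ x := hx.subset ⟨i, rfl⟩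
  -- The hub `h i` is a leaf of the star, so its neighbour in `T` must be the centre.
  have hux : u = x := (starGraph_adj.1 (T.adj_sub hu)).2.resolve_left hne
  rw [Set.eq_univ_iff_forall]
  intro v
  by_cases hv : v = x
  · exact (hux.trans hv.symm) ▸ T.edge_vert hu.symm
  · obtain ⟨i, rfl⟩ := hx.superset hv
    exact hh i

lemma top_mem_hubSubtrees_starGraph [Finite V] :
    (⊤ : (starGraph x).Subgraph) ∈ (starGraph x).hubSubtrees h :=
  (mem_hubSubtrees h).2 ⟨(Iso.isTree_iff Subgraph.topIso).2 (isTree_starGraph x), fun _ => trivial⟩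

/-- In the union of two stars, the second star without the centre of the first one is a subtree. -/
lemma exists_mem_hubSubtrees_sup_starGraph [Finite V]
    (hx : Set.range h = {x}ᶜ) {y : V} (hxy : x ≠ y) :
    ∃ T ∈ (starGraph x ⊔ starGraph y).hubSubtrees h, T.verts = {x}ᶜ := by
  let T : (starGraph x ⊔ starGraph y).Subgraph :=
    { verts := {x}ᶜ
      Adj := fun a b => a ≠ x ∧ b ≠ x ∧ (starGraph y).Adj a b
      adj_sub := fun hab => .inr hab.2.2
      edge_vert := fun hab => hab.1
      symm := ⟨fun a b hab => ⟨hab.2.1, hab.1, hab.2.2.symm⟩⟩ }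
  have hT : T.coe = starGraph ⟨y, hxy.symm⟩ := by
    ext ⟨a, ha⟩ ⟨b, hb⟩
    have ha' : a ≠ x := ha
    have hb' : b ≠ x := hb
    simp [T, ha', hb', Subtype.ext_iff]
  refine ⟨T, (mem_hubSubtrees h).2 ⟨hT ▸ isTree_starGraph _, fun i => hx.subset ⟨i, rfl⟩⟩, rfl⟩

end DoubleStar

/-- Both means have the same drift `r * m / 2`, so their limiting constants decide: the number of
vertices of `V` for the star, strictly less for the union because one averaged subtree omits `x`. -/
lemma eventually_meanSubtreeOrder_hubExtension_lt {V ι : Type*} [Finite V] [Fintype ι] [Nontrivial ι]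
    {x y : V} (hxy : x ≠ y) {h : ι → V} (hinj : h.Injective) (hx : Set.range h = {x}ᶜ) :
    ∀ᶠ m in atTop, ((starGraph x ⊔ starGraph y).hubExtension h m).meanSubtreeOrder <
      ((starGraph x).hubExtension h m).meanSubtreeOrder := by
  obtain ⟨T, hT, hTv⟩ := exists_mem_hubSubtrees_sup_starGraph hx hxy
  have hG := tendsto_meanSubtreeOrder_hubExtension (starGraph x) h
    ⟨_, top_mem_hubSubtrees_starGraph⟩
  have hH := tendsto_meanSubtreeOrder_hubExtension (starGraph x ⊔ starGraph y) h ⟨T, hT⟩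
  have hcG : (((starGraph x).hubSubtrees h).card : ℝ) ≠ 0 := by
    simpa using Finset.ne_empty_of_mem (top_mem_hubSubtrees_starGraph)
  have hcH : 0 < (((starGraph x ⊔ starGraph y).hubSubtrees h).card : ℝ) := by
    simpa using Finset.card_pos.2 ⟨T, hT⟩
  have hGv : (∑ T ∈ (starGraph x).hubSubtrees h, (T.verts.ncard : ℝ)) /
      ((starGraph x).hubSubtrees h).card = Nat.card V := by
    rw [div_eq_iff hcG, Finset.sum_congr rfl fun T hT => by
      rw [verts_eq_univ_of_mem_hubSubtrees hx hinj hT, Set.ncard_univ], Finset.sum_const,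
      nsmul_eq_mul, mul_comm]
  have hHv : (∑ T ∈ (starGraph x ⊔ starGraph y).hubSubtrees h, (T.verts.ncard : ℝ)) /
      ((starGraph x ⊔ starGraph y).hubSubtrees h).card < Nat.card V := by
    rw [div_lt_iff₀ hcH, mul_comm, ← nsmul_eq_mul, ← Finset.sum_const]
    refine Finset.sum_lt_sum (fun T _ => mod_cast Set.ncard_le_card _) ⟨T, hT, ?_⟩
    rw [hTv, ← Set.ncard_univ]
    exact_mod_cast Set.ncard_lt_ncard (by simp [Set.ssubset_univ_iff])
  rw [hGv] at hG
  filter_upwards [hH.eventually_lt hG hHv] with m hm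
  exact_mod_cast sub_lt_sub_iff_right _ |>.1 hm

end SimpleGraph

open SimpleGraph in
theorem theorem1 (k : ℕ) (hk : 0 < k) :
    {n : ℕ | ∃ G H : SimpleGraph (Fin n),
      G.Connected ∧ H.Connected ∧ G ≤ H ∧
      (H.edgeSet \ G.edgeSet).ncard = k ∧
      H.meanSubtreeOrder < G.meanSubtreeOrder}.Infinite := by
  -- At least two hubs are needed: a lone leaf would itself be a non-spanning subtree containing all
  -- hubs.
  have : Nontrivial (Fin (k + 1)) := Fin.nontrivial_iff_two_le.2 (by omega)
  have hxy : (0 : Fin (k + 2)) ≠ 1 := by simp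
  have hev := eventually_meanSubtreeOrder_hubExtension_lt hxy (Fin.succ_injective (k + 1))
    (Fin.range_succ (k + 1))
  obtain ⟨N, hN⟩ := Filter.eventually_atTop.1 hev
  refine Set.infinite_of_forall_exists_gt fun a => ?_
  -- `N` secures the inequality of means, `a` makes the number of vertices exceed `a`.
  set m := max N a
  set G := (starGraph (0 : Fin (k + 2))).hubExtension Fin.succ m
  set H := (starGraph (0 : Fin (k + 2)) ⊔ starGraph 1).hubExtension Fin.succ m
  have hcard : Nat.card (Fin (k + 2) ⊕ Fin (k + 1) × Fin m) = k + 2 + (k + 1) * m := by simp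
  let e : Fin (k + 2) ⊕ Fin (k + 1) × Fin m ≃ Fin (k + 2 + (k + 1) * m) :=
    (Finite.equivFinOfCardEq hcard)
  have hGH : G ≤ H := pendantExtension_mono le_sup_left _
  have hGc : G.Connected := (pendantExtension_connected_iff _).2 (connected_starGraph 0)
  refine ⟨k + 2 + (k + 1) * m, ⟨G.map e, H.map e, ?_, ?_, ?_, ?_, ?_⟩, ?_⟩
  · exact (Iso.connected_iff (Iso.map e G)).1 hGc
  · exact (Iso.connected_iff (Iso.map e H)).1 (hGc.mono hGH)
  · exact map_monotone e hGH
  · have h1 := ncard_edgeSet_pendantExtension_diff (starGraph (0 : Fin (k + 2)))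
      (starGraph 0 ⊔ starGraph 1) (fun p : Fin (k + 1) × Fin m => p.1.succ)
    rw [ncard_edgeSet_sup_starGraph_diff hxy] at h1
    change ((H.map e.toEmbedding).edgeSet \ (G.map e.toEmbedding).edgeSet).ncard = k
    rw [edgeSet_map e.toEmbedding, edgeSet_map e.toEmbedding, ← Set.image_sdiff (Function.Embedding.injective _),
      Set.ncard_image_of_injective _ (Function.Embedding.injective _)]
    simpa using h1
  · rw [← (Iso.map e G).meanSubtreeOrder_eq, ← (Iso.map e H).meanSubtreeOrder_eq]
    exact hN m (le_max_left _ _)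
  · have : a ≤ m := le_max_right _ _
    nlinarith
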